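/- Let $n=2^k$ with $k\ge 1$, and index the $n$ vertices by the strings in $\{0,1\}^k$. In the Hidden Matching problem Alice receives $x\in\{0,1\}^n$ and Bob receives a perfect matching $M$ of the $n$ vertices; Alice outputs $a\in\{0,1\}^{k}$ and Bob outputs $d\in\{0,1\}$ and an unordered pair of vertices $\{i,j\}$. The Hidden Matching distribution is $$\mathrm{HM}(a,d,i,j\mid x,M)=\begin{cases}\dfrac{2}{n^2}&\text{if }\{i,j\}\in M\text{ and }\langle a,i\oplus j\rangle\oplus d=x_i\oplus x_j,\\[1ex]0&\text{otherwise.}\end{cases}$$ For a family of distributions $p=p(\alpha,\beta\mid x,y)$, let $R^{\eta,\rightarrow}_{\epsilon}(p)$ be the least number $c$ of bits such that there is a one-way protocol with shared randomness, in which Alice sends one $c$-bit message to Bob and then each player produces an output or aborts, with the following property: for every input pair $(x,y)$ the probability that some player aborts is at most $1-\eta$, and the distribution $p'(\cdot\mid x,y)$ of the outputs conditioned on neither player aborting satisfies $\sum_{\alpha,\beta}|p'(\alpha,\beta\mid x,y)-p(\alpha,\beta\mid x,y)|\le\epsilon$. There exists a constant $C>0$ such that for every such $n$, every $0<\eta\le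 1$ and every $0\le\epsilon<\eta-\frac12$, $$R^{\eta,\rightarrow}_{\epsilon}(\mathrm{HM})\ \ge\ \frac{\sqrt{n-1}}{2C}-\log_2 n+\log_2\!\left(\eta-\epsilon-\tfrac12\right).$$ -/

import Mathlib

noncomputable section

namespace OneWayComm

/-- A deterministic one-way protocol with `c` bits of communication, for inputs in `X` (Alice) and
`Y` (Bob) and outputs in `A` (Alice) and `B` (Bob). Alice sends one message of `c` bits to Bob, and
each player then outputs a value or aborts; `none` is the abort symbol. -/
structure DetProtocol (X Y A B : Type*) (c : ℕ) where
  /-- the message that Alice sends on input `x` -/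
  message : X → (Fin c → Bool)
  /-- Alice's output on input `x` -/
  outA : X → Option A
  /-- Bob's output on his input and the message received -/
  outB : Y → (Fin c → Bool) → Option B

/-- The pair of outputs of a deterministic protocol on inputs `x`, `y`. -/
def DetProtocol.run {X Y A B : Type*} {c : ℕ} (D : DetProtocol X Y A B c) (x : X) (y : Y) :
    Option A × Option B :=
  (D.outA x, D.outB y (D.message x))

/-- A randomized one-way protocol with shared randomness: a probability distribution over
deterministic one-way protocols. -/
abbrev Protocol (X Y A B : Type*) (c : ℕ) : Type _ := PMF (DetProtocol X Y A B c)

/-- The (unconditioned) probability that on inputs `x`, `y` neither player aborts and the outputs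
are `a`, `b`. -/
def Protocol.outProb {X Y A B : Type*} {c : ℕ} (P : Protocol X Y A B c)
    (x : X) (y : Y) (a : A) (b : B) : ℝ :=
  ((PMF.map (fun D : DetProtocol X Y A B c => D.run x y) P) (some a, some b)).toReal

/-- The efficiency on inputs `x`, `y`: the probability that neither player aborts. -/
def Protocol.efficiency {X Y A B : Type*} [Fintype A] [Fintype B] {c : ℕ} (P : Protocol X Y A B c)
    (x : X) (y : Y) : ℝ :=
  ∑ a, ∑ b, P.outProb x y a b

/-- The distribution of the outputs on inputs `x`, `y`, conditioned on neither player aborting. -/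
def Protocol.condProb {X Y A B : Type*} [Fintype A] [Fintype B] {c : ℕ} (P : Protocol X Y A B c)
    (x : X) (y : Y) (a : A) (b : B) : ℝ :=
  P.outProb x y a b / P.efficiency x y

/-- `P` reproduces `p = p(a,b|x,y)` (written `p x y a b`) with efficiency `η` and error `ε`: for all
inputs it aborts with probability at most `1 - η`, and its output distribution conditioned on not
aborting is at distance `∑ |p' - p| ≤ ε` from `p`. -/
def Protocol.Simulates {X Y A B : Type*} [Fintype A] [Fintype B] {c : ℕ} (P : Protocol X Y A B c)
    (p : X → Y → A → B → ℝ) (η ε : ℝ) : Prop :=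
  ∀ x y, 1 - P.efficiency x y ≤ 1 - η ∧ ∑ a, ∑ b, |P.condProb x y a b - p x y a b| ≤ ε

/-- `R^{η,→}_ε(p)`: the least `c` such that some one-way protocol with `c` bits of communication
reproduces `p` with efficiency `η` and error `ε` (`⊤` if there is none). -/
def R {X Y A B : Type*} [Fintype A] [Fintype B] (p : X → Y → A → B → ℝ) (η ε : ℝ) : ℕ∞ :=
  ⨅ (c : ℕ) (_ : ∃ P : Protocol X Y A B c, P.Simulates p η ε), (c : ℕ∞)

end OneWayComm

namespace HiddenMatching

/-- The `n = 2 ^ k` vertices, labelled by the strings in `{0,1}^k`, with bitwise xor as `+`. -/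
abbrev Vertex (k : ℕ) : Type := Fin k → ZMod 2

/-- Perfect matchings on the vertex set. -/
abbrev Matching (k : ℕ) : Type :=
  {M : (⊤ : SimpleGraph (Vertex k)).Subgraph // M.IsPerfectMatching}

open Classical in
/-- The Hidden Matching distribution `HM(a,d,i,j|x,M)`, `n = 2 ^ k`. Alice's input is
`x ∈ {0,1}^n`, Bob's input is a perfect matching `M`; Alice outputs `a ∈ {0,1}^k`, Bob outputs a bit
`d` and an unordered pair `e = {i,j}`. The value is `2 / n ^ 2` if `{i,j} ∈ M` and
`⟨a, i ⊕ j⟩ ⊕ d = x_i ⊕ x_j`, and `0` otherwise. -/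
def HM (k : ℕ) (x : Vertex k → ZMod 2) (M : Matching k) (a : Fin k → ZMod 2)
    (b : ZMod 2 × Sym2 (Vertex k)) : ℝ :=
  if ∃ i j : Vertex k, b.2 = s(i, j) ∧ M.1.Adj i j ∧ a ⬝ᵥ (i + j) + b.1 = x i + x j
  then 2 / ((2 : ℝ) ^ k) ^ 2 else 0

end HiddenMatching

end

open Finset OneWayComm HiddenMatching

/-! Only the shift matchings `{i, i + s}` with `s 0 = 1` are needed: they are edge-disjoint and lie
in one complete bipartite graph. Score an output `1` if correct, `-1` if wrong, and an abort `0`.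
Small error and high efficiency force expected score at least `1/2` on every input
(`half_le_expected_payoff`), so some deterministic protocol averages at least `1/2` over uniform `x`
and `s`.

Fix Alice's message and output: Bob's answers then pick one edge per `s`, and the total score is at
most a signed sum of `2 ^ k` distinct terms `(-1) ^ (x_u + x_v)` (`payoff_le`). Over random `x` this
decoupled degree-two chaos has typical size `√(2 ^ k)`, with `2p`-th moment at most `(6p) ^ (2p) *
(2 ^ k) ^ p` (`sum_bipartite_chaos_pow_le`). There are `2 ^ (c + k + 1)` pairs (message, output); a
union bound in the `2p`-th moment with `p = c + k + 1` gives `2 ^ k ≤ 288 p ^ 2`. Treating Alice's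
output as extra message is what costs `log₂ n`. -/

/-! ### Moments of Rademacher sums and bipartite chaoses -/

/-- The sign `(-1) ^ u` of a bit `u`. -/
def bitSign (u : ZMod 2) : ℝ := if u = 0 then 1 else -1

theorem bitSign_add (u v : ZMod 2) : bitSign (u + v) = bitSign u * bitSign v := by
  have h : ∀ u v : ZMod 2, (u + v = 0 ↔ u = v) := by decide
  have h' : ∀ u : ZMod 2, u = 0 ∨ u = 1 := by decide
  unfold bitSign
  rcases h' u with rfl | rfl <;> rcases h' v with rfl | rfl <;> simp [h]

theorem bitSign_sq (u : ZMod 2) : bitSign u ^ 2 = 1 := by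
  unfold bitSign; split_ifs <;> norm_num

/-- Independence factors the sum into terms `2 cosh (l w_i)`, and `cosh t ≤ exp (t ^ 2 / 2)`. -/
theorem sum_exp_rademacher_le {V : Type*} [Fintype V] [DecidableEq V] (w : V → ℝ) (l : ℝ) :
    ∑ x : V → ZMod 2, Real.exp (l * ∑ i, w i * bitSign (x i))
      ≤ 2 ^ Fintype.card V * Real.exp (l ^ 2 * (∑ i, w i ^ 2) / 2) := by
  have h1 : ∀ x : V → ZMod 2, Real.exp (l * ∑ i, w i * bitSign (x i))
      = ∏ i, Real.exp (l * (w i * bitSign (x i))) := fun x => by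
    rw [mul_sum, Real.exp_sum]
  have h2 : ∑ x : V → ZMod 2, ∏ i, Real.exp (l * (w i * bitSign (x i)))
      = ∏ i, ∑ u : ZMod 2, Real.exp (l * (w i * bitSign u)) := by
    rw [prod_univ_sum, Fintype.piFinset_univ]
  have h3 : ∀ i, ∑ u : ZMod 2, Real.exp (l * (w i * bitSign u)) = 2 * Real.cosh (l * w i) := by
    intro i
    have : (univ : Finset (ZMod 2)) = {0, 1} := by decide
    rw [this, sum_pair (by decide), Real.cosh_eq]
    simp [bitSign]
    ring
  rw [sum_congr rfl fun x _ => h1 x, h2, prod_congr rfl fun i _ => h3 i, prod_mul_distrib,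
    prod_const, card_univ]
  gcongr
  calc ∏ i, Real.cosh (l * w i) ≤ ∏ i, Real.exp ((l * w i) ^ 2 / 2) :=
        prod_le_prod (fun i _ => (Real.cosh_pos _).le) fun i _ => Real.cosh_le_exp_half_sq _
    _ = Real.exp (l ^ 2 * (∑ i, w i ^ 2) / 2) := by
        rw [← Real.exp_sum, mul_sum, sum_div]
        simp_rw [mul_pow]

/-- Khintchine's inequality for even moments. -/
theorem sum_rademacher_pow_le {V : Type*} [Fintype V] [DecidableEq V] (w : V → ℝ) {p : ℕ}
    (hp : 0 < p) :
    ∑ x : V → ZMod 2, (∑ i, w i * bitSign (x i)) ^ (2 * p)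
      ≤ 2 ^ Fintype.card V * ((6 * p) ^ p * (∑ i, w i ^ 2) ^ p) := by
  set B := ∑ i, w i ^ 2 with hB
  have hB0 : 0 ≤ B := sum_nonneg fun i _ => sq_nonneg _
  rcases hB0.eq_or_lt with h0 | hpos
  · have hw : ∀ i, w i = 0 := fun i => by
      have := (sum_eq_zero_iff_of_nonneg fun i _ => sq_nonneg (w i)).1 h0.symm i (mem_univ i)
      simpa using this
    simp [hw, hp.ne']
    positivity
  have hp' : (0 : ℝ) < p := by exact_mod_cast hp
  -- This `l` minimizes `exp (l ^ 2 * B / 2) / l ^ (2 * p)`. The moment is then read off from the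
  -- single term `t ^ (2p) / (2p)!` of the series of `cosh t`.
  set l := Real.sqrt (2 * p / B) with hl
  have hl2 : l ^ 2 = 2 * p / B := Real.sq_sqrt (by positivity)
  have hexp : l ^ 2 * B / 2 = p := by rw [hl2]; field_simp
  have hc : ∀ x : V → ZMod 2, l ^ (2 * p) * (∑ i, w i * bitSign (x i)) ^ (2 * p)
      ≤ (2 * p) ^ (2 * p) * ((Real.exp (l * ∑ i, w i * bitSign (x i)) +
        Real.exp ((-l) * ∑ i, w i * bitSign (x i))) / 2) := fun x => by
    rw [neg_mul, ← Real.cosh_eq, ← mul_pow]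
    have := le_hasSum (Real.hasSum_cosh (l * ∑ i, w i * bitSign (x i))) p
      fun j _ => div_nonneg ((even_two_mul j).pow_nonneg _) (by positivity)
    rw [div_le_iff₀ (by positivity), mul_comm (Real.cosh _)] at this
    refine this.trans ?_
    gcongr
    exact_mod_cast (Nat.factorial_le_pow (2 * p))
  have hs := sum_le_sum fun x (_ : x ∈ univ) => hc x
  rw [← mul_sum, ← mul_sum, ← sum_div, sum_add_distrib] at hs
  have e1 := sum_exp_rademacher_le w l
  have e2 := sum_exp_rademacher_le w (-l)
  rw [neg_sq] at e2
  rw [← hB, hexp] at e1 e2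
  have he : Real.exp p ≤ 3 ^ p := by
    rw [← Real.exp_one_pow]
    gcongr
    linarith [Real.exp_one_lt_d9]
  have hlp : l ^ (2 * p) = (2 * p) ^ p / B ^ p := by rw [pow_mul, hl2, div_pow]
  rw [hlp] at hs
  have hs' : (2 * (p : ℝ)) ^ p / B ^ p * ∑ x : V → ZMod 2, (∑ i, w i * bitSign (x i)) ^ (2 * p)
      ≤ (2 * p) ^ (2 * p) * (2 ^ Fintype.card V * 3 ^ p) := by
    refine hs.trans ?_
    gcongr
    have : (2 : ℝ) ^ Fintype.card V * Real.exp p ≤ 2 ^ Fintype.card V * 3 ^ p := by gcongr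
    linarith
  have hq : (0 : ℝ) < (2 * (p : ℝ)) ^ p / B ^ p := by positivity
  refine le_of_mul_le_mul_left (hs'.trans_eq ?_) hq
  have : (6 * (p : ℝ)) ^ p = 3 ^ p * (2 * p) ^ p := by rw [← mul_pow]; ring_nf
  rw [this, two_mul p, pow_add]
  field_simp

/-- Moments of a decoupled Rademacher chaos of degree two. -/
theorem sum_bilinear_rademacher_pow_le {V W : Type*} [Fintype V] [DecidableEq V] [Fintype W]
    [DecidableEq W] (w : V → W → ℝ) {p : ℕ} (hp : 0 < p) :
    ∑ y : V → ZMod 2, ∑ z : W → ZMod 2,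
        (∑ j, (∑ i, w i j * bitSign (y i)) * bitSign (z j)) ^ (2 * p)
      ≤ 2 ^ (Fintype.card V + Fintype.card W) *
        ((6 * p) ^ (2 * p) * (∑ j, ∑ i, w i j ^ 2) ^ p) := by
  set s : W → ℝ := fun j => ∑ i, w i j ^ 2 with hs
  set b : (V → ZMod 2) → W → ℝ := fun y j => ∑ i, w i j * bitSign (y i) with hb
  set S := ∑ j, s j with hS
  have hs0 : ∀ j, 0 ≤ s j := fun j => sum_nonneg fun i _ => sq_nonneg _
  have hS0 : 0 ≤ S := sum_nonneg fun j _ => hs0 j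
  have hw : ∀ j, s j = 0 → ∀ i, w i j = 0 := fun j h i => by
    simpa using (sum_eq_zero_iff_of_nonneg fun i _ => sq_nonneg (w i j)).1 h i (mem_univ i)
  have hbs : ∀ y j, s j = 0 → b y j = 0 := fun y j h => by simp [hb, hw j h]
  have key : ∑ y : V → ZMod 2, (∑ j, b y j ^ 2) ^ p
      ≤ 2 ^ Fintype.card V * ((6 * p) ^ p * S ^ p) := by
    rcases hS0.eq_or_lt with h0 | hpos
    · have hz : ∀ j, s j = 0 := fun j =>
        (sum_eq_zero_iff_of_nonneg fun j _ => hs0 j).1 h0.symm j (mem_univ j)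
      simp [hbs _ _ (hz _), hp.ne']
      positivity
    -- Jensen with weights `s j / S` reduces to a single `j`, where Khintchine in `y` applies.
    have hj : ∀ y : V → ZMod 2, (∑ j, b y j ^ 2) ^ p
        ≤ S ^ p * ∑ j, s j / S * ((b y j) ^ (2 * p) / s j ^ p) := fun y => by
      have h1 : ∑ j, b y j ^ 2 = S * ∑ j, s j / S * (b y j ^ 2 / s j) := by
        rw [mul_sum]
        refine sum_congr rfl fun j _ => ?_
        by_cases h : s j = 0
        · simp [hbs y j h, h]
        · field_simp
      rw [h1, mul_pow]
      gcongr
      refine (Real.pow_arith_mean_le_arith_mean_pow univ _ _ (fun j _ => by have := hs0 j; positivity)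
        (by rw [← sum_div, ← hS, div_self hpos.ne']) (fun j _ => by have := hs0 j; positivity) p).trans_eq ?_
      simp_rw [div_pow, ← pow_mul]
    refine (sum_le_sum fun y _ => hj y).trans ?_
    rw [← mul_sum, sum_comm]
    have hk : ∀ j, ∑ y : V → ZMod 2, s j / S * ((b y j) ^ (2 * p) / s j ^ p)
        ≤ s j / S * (2 ^ Fintype.card V * (6 * p) ^ p) := fun j => by
      rw [← mul_sum, ← sum_div]
      have := hs0 j
      gcongr
      refine div_le_of_le_mul₀ (by positivity) (by positivity) ?_
      have := sum_rademacher_pow_le (fun i => w i j) hp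
      simpa only [mul_assoc] using this
    calc S ^ p * ∑ j, ∑ y : V → ZMod 2, s j / S * ((b y j) ^ (2 * p) / s j ^ p)
        ≤ S ^ p * ∑ j, s j / S * (2 ^ Fintype.card V * (6 * p) ^ p) := by
          gcongr with j; exact hk j
      _ = _ := by
          rw [← sum_mul, ← sum_div, ← hS, div_self hpos.ne']; ring
  calc ∑ y : V → ZMod 2, ∑ z : W → ZMod 2, (∑ j, b y j * bitSign (z j)) ^ (2 * p)
      ≤ ∑ y : V → ZMod 2, 2 ^ Fintype.card W * ((6 * p) ^ p * (∑ j, b y j ^ 2) ^ p) := by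
        gcongr with y; exact sum_rademacher_pow_le (b y) hp
    _ = 2 ^ Fintype.card W * (6 * p) ^ p * ∑ y : V → ZMod 2, (∑ j, b y j ^ 2) ^ p := by
        rw [mul_sum]; simp_rw [mul_assoc]
    _ ≤ 2 ^ Fintype.card W * (6 * p) ^ p * (2 ^ Fintype.card V * ((6 * p) ^ p * S ^ p)) := by
        gcongr
    _ = _ := by rw [pow_add, two_mul p, pow_add]; ring

/-- Moments of a Rademacher chaos whose edges form a simple bipartite graph. -/
theorem sum_bipartite_chaos_pow_le {V T : Type*} [Fintype V] [DecidableEq V] [Fintype T]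
    (P : V → Prop) [DecidablePred P] (σ : T → ℝ) (u : T → {i // P i}) (v : T → {i // ¬ P i})
    (huv : Function.Injective fun t => (u t, v t)) {p : ℕ} (hp : 0 < p) :
    ∑ x : V → ZMod 2, (∑ t, σ t * (bitSign (x (u t)) * bitSign (x (v t)))) ^ (2 * p)
      ≤ 2 ^ Fintype.card V * ((6 * p) ^ (2 * p) * (∑ t, σ t ^ 2) ^ p) := by
  classical
  set w : {i // P i} → {i // ¬ P i} → ℝ := fun i j => ∑ t, if (u t, v t) = (i, j) then σ t else 0
    with hw
  -- By injectivity each matrix entry receives at most one `σ t`, so squaring produces no cross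
  -- terms.
  have hw2 : ∀ i j, w i j ^ 2 = ∑ t, if (u t, v t) = (i, j) then σ t ^ 2 else 0 := fun i j => by
    by_cases h : ∃ t, (u t, v t) = (i, j)
    · obtain ⟨t, ht⟩ := h
      have : ∀ t', (u t', v t') = (i, j) ↔ t' = t := fun t' =>
        ⟨fun h => huv (h.trans ht.symm), fun h => h ▸ ht⟩
      simp only [hw, this]
      simp
    · push Not at h
      simp only [hw, h, if_false, sum_const_zero]
      simp
  have hsum : ∑ j, ∑ i, w i j ^ 2 = ∑ t, σ t ^ 2 := by
    rw [sum_comm]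
    simp_rw [hw2]
    rw [← Fintype.sum_prod_type' fun i j => ∑ t, if (u t, v t) = (i, j) then σ t ^ 2 else 0,
      sum_comm]
    simp
  have h := sum_bilinear_rademacher_pow_le w hp
  rw [hsum, Fintype.card_subtype_compl, Nat.add_sub_cancel' (Fintype.card_subtype_le P),
    ← Fintype.sum_prod_type'] at h
  refine le_of_eq_of_le ?_ h
  refine Fintype.sum_equiv (Equiv.piEquivPiSubtypeProd P fun _ => ZMod 2) _ _ fun x => ?_
  congr 1
  simp only [Equiv.piEquivPiSubtypeProd_apply, hw, sum_mul]
  rw [sum_comm, ← Fintype.sum_prod_type' fun i j => ∑ t, (if (u t, v t) = (i, j) then σ t else 0) *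
    bitSign (x i) * bitSign (x j), sum_comm]
  simp [mul_assoc, ite_mul]

/-! ### Shift matchings -/

/-- The vectors whose first bit is `1`. -/
abbrev OddVertex (k : ℕ) : Type := {s : Vertex (k + 1) // s 0 = 1}

theorem card_vertex_head_eq (k : ℕ) (a : ZMod 2) :
    Fintype.card {i : Vertex (k + 1) // i 0 = a} = 2 ^ k := by
  have e : {i : Vertex (k + 1) // i 0 = a} ≃ Vertex k :=
    { toFun := fun i => Fin.tail i.1
      invFun := fun f => ⟨Fin.cons a f, rfl⟩
      left_inv := fun ⟨i, hi⟩ => by subst hi; simp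
      right_inv := fun f => by simp }
  rw [Fintype.card_congr e]
  simp [ZMod.card]

theorem vertex_add_self {k : ℕ} (i : Vertex k) : i + i = 0 :=
  funext fun _ => CharTwo.add_self_eq_zero _

theorem vertex_add_eq_iff {k : ℕ} (i j s : Vertex k) : i + j = s ↔ j = i + s := by
  constructor
  · rintro rfl
    rw [← add_assoc, vertex_add_self, zero_add]
  · rintro rfl
    rw [← add_assoc, vertex_add_self, zero_add]

/-- The perfect matching that joins each vertex `i` to `i + s`. -/
def shiftMatching {k : ℕ} (s : OddVertex k) : Matching (k + 1) :=
  ⟨{ verts := Set.univ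
     Adj := fun i j => i + j = s
     adj_sub := by
       rintro i j h
       rw [SimpleGraph.top_adj]
       rintro rfl
       rw [vertex_add_self] at h
       have := congrFun h 0
       rw [s.2] at this
       exact zero_ne_one this
     edge_vert := fun _ => Set.mem_univ _
     symm := ⟨fun i j h => (add_comm j i).trans h⟩ },
   ⟨fun i _ => ⟨i + s, (vertex_add_eq_iff _ _ _).2 rfl, fun j h => (vertex_add_eq_iff _ _ _).1 h⟩,
    fun i => Set.mem_univ _⟩⟩

theorem shiftMatching_adj {k : ℕ} (s : OddVertex k) (i j : Vertex (k + 1)) :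
    (shiftMatching s).1.Adj i j ↔ i + j = s := Iff.rfl

/-! ### The payoff and its bound by a quadratic form -/

/-- The outputs that are correct for the Hidden Matching problem. -/
def IsCorrect {k : ℕ} (x : Vertex k → ZMod 2) (M : Matching k) (a : Fin k → ZMod 2)
    (b : ZMod 2 × Sym2 (Vertex k)) : Prop :=
  ∃ i j : Vertex k, b.2 = s(i, j) ∧ M.1.Adj i j ∧ a ⬝ᵥ (i + j) + b.1 = x i + x j

open Classical in
/-- The payoff of an output: `1` if it is correct and `-1` otherwise. -/
noncomputable def payoff {k : ℕ} (x : Vertex k → ZMod 2) (M : Matching k) (a : Fin k → ZMod 2)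
    (b : ZMod 2 × Sym2 (Vertex k)) : ℝ := if IsCorrect x M a b then 1 else -1

open Classical in
theorem HM_eq {k : ℕ} (x : Vertex k → ZMod 2) (M : Matching k) (a : Fin k → ZMod 2)
    (b : ZMod 2 × Sym2 (Vertex k)) :
    HM k x M a b = if IsCorrect x M a b then 2 / ((2 : ℝ) ^ k) ^ 2 else 0 := by
  unfold HM IsCorrect
  congr

theorem isCorrect_shiftMatching_iff {k : ℕ} (x : Vertex (k + 1) → ZMod 2) (s : OddVertex k)
    (a : Fin (k + 1) → ZMod 2) (b : ZMod 2 × Sym2 (Vertex (k + 1))) :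
    IsCorrect x (shiftMatching s) a b ↔ ∃ i : {i : Vertex (k + 1) // i 0 = 0},
      b.2 = s(i.1, i.1 + s) ∧ a ⬝ᵥ s.1 + b.1 = x i + x (i.1 + s) := by
  constructor
  · rintro ⟨i, j, he, hM, hx⟩
    rw [shiftMatching_adj] at hM
    rw [hM] at hx
    have hj := (vertex_add_eq_iff _ _ _).1 hM
    have hi := (vertex_add_eq_iff _ _ _).1 ((add_comm j i).trans hM)
    by_cases h0 : i 0 = 0
    · refine ⟨⟨i, h0⟩, ?_, ?_⟩
      · rw [he, ← hj]
      · rw [hx, ← hj]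
    · have h1 : j 0 = 0 := by
        have h2 : ∀ u v : ZMod 2, u ≠ 0 → u + v = 1 → v = 0 := by decide
        refine h2 _ _ h0 ?_
        rw [← s.2, ← hM, Pi.add_apply]
      refine ⟨⟨j, h1⟩, ?_, ?_⟩
      · rw [he, ← hi, Sym2.eq_swap]
      · rw [hx, ← hi, add_comm]
  · rintro ⟨i, he, hx⟩
    have h := (vertex_add_eq_iff i.1 (i.1 + s) s).2 rfl
    exact ⟨i, i + s, he, h, by rw [h, hx]⟩

open Classical in
/-- The endpoint with first bit `0` of an edge `{i, i + s}`. -/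
noncomputable def evenEnd {k : ℕ} (s : OddVertex k) (e : Sym2 (Vertex (k + 1))) :
    {i : Vertex (k + 1) // i 0 = 0} :=
  -- The default is harmless: `oddEnd` is still its shift by `s`, so the terms for different `s`
  -- keep distinct edges.
  if h : ∃ i : {i : Vertex (k + 1) // i 0 = 0}, e = s(i.1, i.1 + s) then h.choose else ⟨0, rfl⟩

/-- The endpoint with first bit `1` of an edge `{i, i + s}`. -/
noncomputable def oddEnd {k : ℕ} (s : OddVertex k) (e : Sym2 (Vertex (k + 1))) :
    {i : Vertex (k + 1) // ¬ i 0 = 0} :=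
  ⟨(evenEnd s e).1 + s.1, by rw [Pi.add_apply, (evenEnd s e).2, s.2, zero_add]; exact one_ne_zero⟩

theorem evenEnd_add_oddEnd {k : ℕ} (s : OddVertex k) (e : Sym2 (Vertex (k + 1))) :
    (evenEnd s e).1 + (oddEnd s e).1 = s := (vertex_add_eq_iff _ _ _).2 rfl

open Classical in
/-- The coefficient of the answer `(a, b)` in the quadratic form bounding the payoff. -/
noncomputable def edgeCoeff {k : ℕ} (s : OddVertex k) (a : Fin (k + 1) → ZMod 2)
    (b : ZMod 2 × Sym2 (Vertex (k + 1))) : ℝ :=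
  if b.2 = s((evenEnd s b.2).1, (oddEnd s b.2).1) then bitSign (a ⬝ᵥ s.1 + b.1) else 0

theorem edgeCoeff_sq_le {k : ℕ} (s : OddVertex k) (a : Fin (k + 1) → ZMod 2)
    (b : ZMod 2 × Sym2 (Vertex (k + 1))) : edgeCoeff s a b ^ 2 ≤ 1 := by
  unfold edgeCoeff
  split_ifs
  · exact (bitSign_sq _).le
  · norm_num

/-- Equality holds when the edge lies in the matching; otherwise the coefficient is `0` and the
payoff `-1`. -/
theorem payoff_le {k : ℕ} (x : Vertex (k + 1) → ZMod 2) (s : OddVertex k)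
    (a : Fin (k + 1) → ZMod 2) (b : ZMod 2 × Sym2 (Vertex (k + 1))) :
    payoff x (shiftMatching s) a b ≤
      edgeCoeff s a b * (bitSign (x (evenEnd s b.2)) * bitSign (x (oddEnd s b.2))) := by
  have hb : ∀ u : ZMod 2, -1 ≤ bitSign u := fun u => by
    unfold bitSign; split_ifs <;> norm_num
  by_cases hc : IsCorrect x (shiftMatching s) a b
  · obtain ⟨i, he, hx⟩ := (isCorrect_shiftMatching_iff x s a b).1 hc
    have hex : ∃ i : {i : Vertex (k + 1) // i 0 = 0}, b.2 = s(i.1, i.1 + s) := ⟨i, he⟩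
    have hend : b.2 = s((evenEnd s b.2).1, (oddEnd s b.2).1) := by
      have h1 := hex.choose_spec
      have h2 : evenEnd s b.2 = hex.choose := dif_pos hex
      simpa only [oddEnd, h2] using h1
    have hi : i.1 = (evenEnd s b.2).1 ∧ i.1 + s = (oddEnd s b.2).1 := by
      rcases Sym2.eq_iff.1 (he.symm.trans hend) with h | h
      · exact h
      · exact absurd i.2 (h.1 ▸ (oddEnd s b.2).2)
    rw [payoff, if_pos hc, edgeCoeff, if_pos hend, ← hi.2, ← hi.1, ← bitSign_add, hx,
      ← pow_two, bitSign_sq]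
  · rw [payoff, if_neg hc, edgeCoeff]
    split_ifs
    · rw [← bitSign_add, ← bitSign_add]; exact hb _
    · norm_num

/-! ### Expected payoff of a simulating protocol -/

/-- The expected value of `f` over the outputs of `P` is a convex combination of its values on the
outputs of deterministic protocols. -/
theorem sum_outProb_mul {X Y A B : Type*} [Fintype A] [Fintype B] {c : ℕ}
    [DecidableEq A] [DecidableEq B] [Fintype (DetProtocol X Y A B c)] (P : Protocol X Y A B c) (x : X) (y : Y) (f : A → B → ℝ) :
    ∑ a, ∑ b, P.outProb x y a b * f a b = ∑ D : DetProtocol X Y A B c, (P D).toReal *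
      ∑ a, ∑ b, if D.run x y = (some a, some b) then f a b else 0 := by
  have h : ∀ a b, P.outProb x y a b = ∑ D : DetProtocol X Y A B c,
      if D.run x y = (some a, some b) then (P D).toReal else 0 := fun a b => by
    unfold Protocol.outProb
    rw [PMF.map_apply, tsum_fintype, ENNReal.toReal_sum]
    · refine sum_congr rfl fun D _ => ?_
      rw [apply_ite ENNReal.toReal, ENNReal.toReal_zero]
      by_cases h : D.run x y = (some a, some b)
      · rw [if_pos h, if_pos h.symm]
      · rw [if_neg h, if_neg (Ne.symm h)]
    · intro D _
      split_ifs
      · exact P.apply_ne_top D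
      · exact ENNReal.zero_ne_top
  simp_rw [h, sum_mul, mul_sum]
  simp_rw [sum_comm (s := (univ : Finset B)) (t := (univ : Finset (DetProtocol X Y A B c)))]
  rw [sum_comm]
  refine sum_congr rfl fun D _ => sum_congr rfl fun a _ => sum_congr rfl fun b _ => ?_
  split_ifs <;> simp

instance {X Y A B : Type*} [Finite X] [Finite Y] [Finite A] [Finite B] (c : ℕ) :
    Finite (DetProtocol X Y A B c) := by
  refine Finite.of_injective (β := (X → Fin c → Bool) × (X → Option A) ×
    (Y → (Fin c → Bool) → Option B)) (fun D => (D.message, D.outA, D.outB)) ?_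
  rintro ⟨_, _, _⟩ ⟨_, _, _⟩ h
  simpa using h

theorem sum_toReal_pmf {α : Type*} [Fintype α] (P : PMF α) : ∑ a, (P a).toReal = 1 := by
  rw [← ENNReal.toReal_sum fun a _ => P.apply_ne_top a, (tsum_fintype _).symm.trans P.tsum_coe,
    ENNReal.toReal_one]

/-- On a shift matching, the Hidden Matching distribution has total mass at least one. -/
theorem one_le_sum_HM {k : ℕ} (x : Vertex (k + 1) → ZMod 2) (s : OddVertex k) :
    1 ≤ ∑ a, ∑ b, HM (k + 1) x (shiftMatching s) a b := by
  classical
  have h : ∀ a : Fin (k + 1) → ZMod 2, 2 ^ k * (2 / ((2 : ℝ) ^ (k + 1)) ^ 2)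
      ≤ ∑ b, HM (k + 1) x (shiftMatching s) a b := fun a => by
    set g : {i : Vertex (k + 1) // i 0 = 0} → ZMod 2 × Sym2 (Vertex (k + 1)) := fun i =>
      (x i + x (i.1 + s) - a ⬝ᵥ s.1, s(i.1, i.1 + s)) with hg
    have hinj : Function.Injective g := fun i j hij => by
      rcases Sym2.eq_iff.1 (congrArg Prod.snd hij) with h | h
      · exact Subtype.ext h.1
      · have h1 := congrFun h.1 0
        rw [i.2, Pi.add_apply, j.2, s.2] at h1
        exact absurd h1 (by decide)
    have hval : ∀ i, HM (k + 1) x (shiftMatching s) a (g i) = 2 / ((2 : ℝ) ^ (k + 1)) ^ 2 :=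
      fun i => by
        rw [HM_eq, if_pos]
        exact (isCorrect_shiftMatching_iff x s a _).2 ⟨i, rfl, add_sub_cancel _ _⟩
    calc 2 ^ k * (2 / ((2 : ℝ) ^ (k + 1)) ^ 2)
        = ∑ i, HM (k + 1) x (shiftMatching s) a (g i) := by
          simp_rw [hval]
          rw [sum_const, card_univ, card_vertex_head_eq, nsmul_eq_mul]
          push_cast; rfl
      _ = ∑ b ∈ univ.image g, HM (k + 1) x (shiftMatching s) a b :=
          (sum_image fun i _ j _ h => hinj h).symm
      _ ≤ _ := sum_le_sum_of_subset_of_nonneg (subset_univ _) fun b _ _ => by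
          rw [HM_eq]; split_ifs <;> positivity
  refine le_trans (le_of_eq ?_) (sum_le_sum fun a (_ : a ∈ univ) => h a)
  rw [sum_const, card_univ, Fintype.card_fun, ZMod.card, Fintype.card_fin, nsmul_eq_mul]
  push_cast
  rw [pow_succ]
  field_simp

theorem half_le_expected_payoff {k c : ℕ} {η ε : ℝ}
    {P : Protocol (Vertex (k + 1) → ZMod 2) (Matching (k + 1)) (Fin (k + 1) → ZMod 2)
      (ZMod 2 × Sym2 (Vertex (k + 1))) c}
    (hP : P.Simulates (HM (k + 1)) η ε) (hη : η ≤ 1) (hε : 0 ≤ ε) (hηε : ε < η - 1 / 2)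
    (x : Vertex (k + 1) → ZMod 2) (s : OddVertex k) :
    1 / 2 ≤ ∑ a, ∑ b, P.outProb x (shiftMatching s) a b * payoff x (shiftMatching s) a b := by
  obtain ⟨h1, h2⟩ := hP x (shiftMatching s)
  set M := shiftMatching s
  have he : η ≤ P.efficiency x M := by linarith
  have he0 : P.efficiency x M ≠ 0 := by linarith
  -- Correct outputs are exactly the support of `HM`, so the pointwise loss is at most the pointwise
  -- error.
  have hcond : ∀ a b, HM (k + 1) x M a b - |P.condProb x M a b - HM (k + 1) x M a b|
      ≤ P.condProb x M a b * payoff x M a b := fun a b => by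
    rw [HM_eq, payoff]
    split_ifs
    · linarith [neg_abs_le (P.condProb x M a b - 2 / ((2 : ℝ) ^ (k + 1)) ^ 2)]
    · rw [sub_zero]; linarith [le_abs_self (P.condProb x M a b)]
  have hsum := sum_le_sum fun a (_ : a ∈ univ) => sum_le_sum fun b (_ : b ∈ univ) => hcond a b
  simp_rw [sum_sub_distrib] at hsum
  have h3 : 1 - ε ≤ ∑ a, ∑ b, P.condProb x M a b * payoff x M a b := by
    linarith [one_le_sum_HM x s]
  have h4 : ∑ a, ∑ b, P.outProb x M a b * payoff x M a b
      = P.efficiency x M * ∑ a, ∑ b, P.condProb x M a b * payoff x M a b := by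
    simp_rw [mul_sum, Protocol.condProb]
    refine sum_congr rfl fun a _ => sum_congr rfl fun b _ => ?_
    field_simp
  rw [h4]
  -- Since `η ≤ 1`, `η * (1 - ε) ≥ η - ε > 1 / 2`.
  calc (1 / 2 : ℝ) ≤ η * (1 - ε) := by nlinarith
    _ ≤ _ := mul_le_mul he h3 (by linarith) (by linarith)

/-! ### Union bound over messages and the final estimate -/

/-- The total payoff of a deterministic protocol with few bits is small. -/
theorem le_of_half_le_total_payoff {k c : ℕ}
    (D : DetProtocol (Vertex (k + 1) → ZMod 2) (Matching (k + 1)) (Fin (k + 1) → ZMod 2)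
      (ZMod 2 × Sym2 (Vertex (k + 1))) c) (F : (Vertex (k + 1) → ZMod 2) → OddVertex k → ℝ)
    (hF : ∀ x s a b, D.run x (shiftMatching s) = (some a, some b) →
      F x s = payoff x (shiftMatching s) a b)
    (hF0 : ∀ x s, (∀ a b, D.run x (shiftMatching s) ≠ (some a, some b)) → F x s = 0)
    (hle : (2 : ℝ) ^ 2 ^ (k + 1) * (2 ^ k / 2) ≤ ∑ x, ∑ s, F x s) :
    (2 : ℝ) ^ k ≤ 288 * ((c + (k + 1) : ℕ) : ℝ) ^ 2 := by
  classical
  set p := c + (k + 1) with hp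
  have hp0 : 0 < p := by omega
  -- Alice's output is adjoined to the message, so that the form depends on `x` only through the
  -- signs. When Bob aborts the coefficient is `0` and the edge arbitrary.
  set σ : (Fin c → Bool) × (Fin (k + 1) → ZMod 2) → OddVertex k → ℝ := fun m s =>
    ((D.outB (shiftMatching s) m.1).map (edgeCoeff s m.2)).getD 0 with hσ
  set e : (Fin c → Bool) → OddVertex k → Sym2 (Vertex (k + 1)) := fun m s =>
    ((D.outB (shiftMatching s) m).map Prod.snd).getD s(0, 0) with he
  set Q : (Fin c → Bool) × (Fin (k + 1) → ZMod 2) → (Vertex (k + 1) → ZMod 2) → ℝ := fun m x =>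
    ∑ s, σ m s * (bitSign (x (evenEnd s (e m.1 s))) * bitSign (x (oddEnd s (e m.1 s)))) with hQ
  have hσ1 : ∀ m s, σ m s ^ 2 ≤ 1 := fun m s => by
    simp only [hσ]
    cases D.outB (shiftMatching s) m.1 with
    | none => simp
    | some b => simpa using edgeCoeff_sq_le s m.2 b
  have hQp : ∀ m, ∑ x, Q m x ^ (2 * p)
      ≤ 2 ^ 2 ^ (k + 1) * ((6 * p) ^ (2 * p) * (2 ^ k) ^ p) := fun m => by
    have h := sum_bipartite_chaos_pow_le (fun i : Vertex (k + 1) => i 0 = 0) (σ m)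
      (fun s => evenEnd s (e m.1 s)) (fun s => oddEnd s (e m.1 s)) (fun s t hst => by
        have h1 := congrArg (fun q => q.1.1 + q.2.1) hst
        simp only [evenEnd_add_oddEnd] at h1
        exact Subtype.ext h1) hp0
    have hc : Fintype.card (Vertex (k + 1)) = 2 ^ (k + 1) := by simp [ZMod.card]
    rw [hc] at h
    refine h.trans ?_
    gcongr
    refine (sum_le_sum fun s _ => hσ1 m s).trans_eq ?_
    rw [sum_const, card_univ, card_vertex_head_eq]
    simp
  have hmax : ∀ x, ∃ m, ∑ s, F x s ≤ |Q m x| := fun x => by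
    cases ha : D.outA x with
    | none =>
      refine ⟨(D.message x, 0), le_trans (le_of_eq ?_) (abs_nonneg _)⟩
      refine sum_eq_zero fun s _ => hF0 x s fun a b h => ?_
      simp [DetProtocol.run, ha] at h
    | some a =>
      refine ⟨(D.message x, a), le_trans (sum_le_sum fun s _ => ?_) (le_abs_self _)⟩
      cases hb : D.outB (shiftMatching s) (D.message x) with
      | none =>
        rw [hF0 x s fun a b h => by simp [DetProtocol.run, hb] at h]
        simp [hσ, hb]
      | some b =>
        rw [hF x s a b (by simp [DetProtocol.run, ha, hb])]
        simpa [hσ, he, hb] using payoff_le x s a b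
  choose m hm using hmax
  have hcardX : (Fintype.card (Vertex (k + 1) → ZMod 2) : ℝ) = 2 ^ 2 ^ (k + 1) := by
    simp [ZMod.card]
  have hcardm : (Fintype.card ((Fin c → Bool) × (Fin (k + 1) → ZMod 2)) : ℝ) = 2 ^ p := by
    simp [ZMod.card, hp, pow_add]
  have hmean : ((2 : ℝ) ^ k / 2) ^ (2 * p)
      ≤ ∑ x, ((2 : ℝ) ^ 2 ^ (k + 1))⁻¹ * Q (m x) x ^ (2 * p) := by
    have h := Real.pow_arith_mean_le_arith_mean_pow_of_even (univ : Finset (Vertex (k + 1) → ZMod 2))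
      (fun _ => ((2 : ℝ) ^ 2 ^ (k + 1))⁻¹) (fun x => |Q (m x) x|) (fun _ _ => by positivity)
      (by rw [sum_const, card_univ, nsmul_eq_mul, hcardX]; field_simp) (even_two_mul p)
    simp_rw [(even_two_mul p).pow_abs] at h
    refine le_trans ?_ h
    gcongr
    rw [← mul_sum, ← div_eq_inv_mul, le_div_iff₀ (by positivity), mul_comm]
    exact hle.trans (sum_le_sum fun x _ => hm x)
  have hall : ∑ x, ((2 : ℝ) ^ 2 ^ (k + 1))⁻¹ * Q (m x) x ^ (2 * p)
      ≤ 2 ^ p * ((6 * p) ^ (2 * p) * (2 ^ k) ^ p) := by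
    rw [← mul_sum, ← div_eq_inv_mul, div_le_iff₀ (by positivity)]
    -- The index `m x` depends on `x`; summing over all `2 ^ p` indices removes this dependence.
    calc ∑ x, Q (m x) x ^ (2 * p) ≤ ∑ x, ∑ m, Q m x ^ (2 * p) := by
          gcongr with x
          exact single_le_sum (f := fun m => Q m x ^ (2 * p))
            (fun m _ => (even_two_mul p).pow_nonneg _) (mem_univ _)
      _ = ∑ m, ∑ x, Q m x ^ (2 * p) := sum_comm
      _ ≤ ∑ m : (Fin c → Bool) × (Fin (k + 1) → ZMod 2),
          2 ^ 2 ^ (k + 1) * ((6 * (p : ℝ)) ^ (2 * p) * (2 ^ k) ^ p) :=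
          sum_le_sum fun m _ => hQp m
      _ = _ := by
          rw [sum_const, card_univ, nsmul_eq_mul, hcardm]; ring
  have hfin := hmean.trans hall
  rw [pow_mul, pow_mul, ← mul_pow, ← mul_pow] at hfin
  -- Taking `p`-th roots turns the factor `2 ^ p` into `2`: `(2 ^ k / 2) ^ 2 ≤ 2 * (6 * p) ^ 2 * 2 ^
  -- k`, whence `288 = 4 * 2 * 36`.
  have hbase := le_of_pow_le_pow_left₀ hp0.ne' (by positivity) hfin
  have hN : (0 : ℝ) < 2 ^ k := by positivity
  refine le_of_mul_le_mul_left ?_ hN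
  nlinarith

theorem two_pow_le_of_simulates {k c : ℕ} {η ε : ℝ}
    {P : Protocol (Vertex (k + 1) → ZMod 2) (Matching (k + 1)) (Fin (k + 1) → ZMod 2)
      (ZMod 2 × Sym2 (Vertex (k + 1))) c}
    (hP : P.Simulates (HM (k + 1)) η ε) (hη : η ≤ 1) (hε : 0 ≤ ε) (hηε : ε < η - 1 / 2) :
    (2 : ℝ) ^ k ≤ 288 * ((c + (k + 1) : ℕ) : ℝ) ^ 2 := by
  classical
  let _ : Fintype (DetProtocol (Vertex (k + 1) → ZMod 2) (Matching (k + 1)) (Fin (k + 1) → ZMod 2)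
      (ZMod 2 × Sym2 (Vertex (k + 1))) c) := Fintype.ofFinite _
  set F := fun (D : DetProtocol (Vertex (k + 1) → ZMod 2) (Matching (k + 1))
      (Fin (k + 1) → ZMod 2) (ZMod 2 × Sym2 (Vertex (k + 1))) c) (x : Vertex (k + 1) → ZMod 2)
      (s : OddVertex k) => ∑ a, ∑ b, if D.run x (shiftMatching s) = (some a, some b)
        then payoff x (shiftMatching s) a b else 0 with hF
  have hlow : (2 : ℝ) ^ 2 ^ (k + 1) * (2 ^ k / 2)
      ≤ ∑ D, (P D).toReal * ∑ x, ∑ s, F D x s := by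
    have h1 : ∀ x s, 1 / 2 ≤ ∑ D, (P D).toReal * F D x s := fun x s => by
      exact (half_le_expected_payoff hP hη hε hηε x s).trans_eq (sum_outProb_mul P x _ _)
    have h2 := sum_le_sum fun x (_ : x ∈ univ) => sum_le_sum fun s (_ : s ∈ univ) => h1 x s
    refine le_of_eq_of_le ?_ (h2.trans_eq ?_)
    · simp only [sum_const, card_univ, nsmul_eq_mul]
      rw [card_vertex_head_eq]
      simp [ZMod.card]
      ring
    · simp_rw [mul_sum]
      simp_rw [sum_comm (s := (univ : Finset (OddVertex k)))]
      rw [sum_comm]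
  obtain ⟨D, hD⟩ : ∃ D, (2 : ℝ) ^ 2 ^ (k + 1) * (2 ^ k / 2) ≤ ∑ x, ∑ s, F D x s := by
    by_contra! hcon
    have h0 := sum_toReal_pmf P
    obtain ⟨D₀, hD₀⟩ : ∃ D, 0 < (P D).toReal := by
      by_contra! h
      linarith [sum_nonpos fun D (_ : D ∈ univ) => h D]
    have := sum_lt_sum (s := univ) (f := fun D => (P D).toReal * ∑ x, ∑ s, F D x s)
      (g := fun D => (P D).toReal * ((2 : ℝ) ^ 2 ^ (k + 1) * (2 ^ k / 2)))
      (fun D _ => mul_le_mul_of_nonneg_left (hcon D).le ENNReal.toReal_nonneg)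
      ⟨D₀, mem_univ _, mul_lt_mul_of_pos_left (hcon D₀) hD₀⟩
    rw [← sum_mul, h0, one_mul] at this
    linarith
  refine le_of_half_le_total_payoff D (F D) (fun x s a b h => ?_) (fun x s h => ?_) hD
  · simp only [hF, h, Prod.mk.injEq, Option.some.injEq]
    rw [sum_eq_single a (fun a' _ h => sum_eq_zero fun b _ => if_neg fun h' => h h'.1.symm)
      (by simp), sum_eq_single b (fun b' _ h => if_neg fun h' => h h'.2.symm) (by simp)]
    simp
  · simp [hF, h]

theorem corollary4p5 :
    ∃ C : ℝ, 0 < C ∧ ∀ (n k : ℕ), 1 ≤ k → n = 2 ^ k →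
      ∀ η ε : ℝ, 0 < η → η ≤ 1 → 0 ≤ ε → ε < η - 1 / 2 →
        ((Real.sqrt ((n : ℝ) - 1) / (2 * C) - Real.logb 2 (n : ℝ)
            + Real.logb 2 (η - ε - 1 / 2) : ℝ) : EReal)
          ≤ ((OneWayComm.R (HiddenMatching.HM k) η ε : ENNReal) : EReal) := by
  -- `n = 2 * 2 ^ k ≤ 576 p ^ 2 = (24 p) ^ 2`, and `24 = 2 * 12`.
  refine ⟨12, by norm_num, ?_⟩
  rintro n k hk rfl η ε - hη hε hηε
  obtain ⟨k, rfl⟩ := Nat.exists_eq_add_of_le' hk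
  rcases eq_or_ne (R (HM (k + 1)) η ε) ⊤ with htop | hne
  · rw [htop]; simp
  obtain ⟨r, hr⟩ := ENat.ne_top_iff_exists.1 hne
  have hlt : R (HM (k + 1)) η ε < ((r + 1 : ℕ) : ℕ∞) := by
    rw [← hr]; exact_mod_cast Nat.lt_succ_self r
  unfold R at hlt
  simp only [iInf_lt_iff] at hlt
  obtain ⟨c, ⟨P, hP⟩, hc⟩ := hlt
  have hcr : c ≤ r := Nat.lt_succ_iff.1 (by exact_mod_cast hc)
  have h := two_pow_le_of_simulates hP hη hε hηε
  have hlog : Real.logb 2 (((2 ^ (k + 1) : ℕ) : ℝ)) = k + 1 := by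
    push_cast
    rw [← Nat.cast_succ, ← Real.rpow_natCast, Real.logb_rpow (by norm_num) (by norm_num)]
  -- The last logarithm is nonpositive, so it only weakens the bound.
  have hδ : Real.logb 2 (η - ε - 1 / 2) ≤ 0 :=
    Real.logb_nonpos (by norm_num) (by linarith) (by linarith)
  have hsqrt : Real.sqrt (((2 ^ (k + 1) : ℕ) : ℝ) - 1) ≤ 24 * ((c + (k + 1) : ℕ) : ℝ) := by
    refine Real.sqrt_le_iff.2 ⟨by positivity, ?_⟩
    push_cast at h ⊢
    rw [pow_succ]
    nlinarith
  have hmain : Real.sqrt (((2 ^ (k + 1) : ℕ) : ℝ) - 1) / (2 * 12)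
      - Real.logb 2 (((2 ^ (k + 1) : ℕ) : ℝ)) + Real.logb 2 (η - ε - 1 / 2) ≤ r := by
    rw [hlog]
    have : (c : ℝ) ≤ r := by exact_mod_cast hcr
    push_cast at hsqrt ⊢
    linarith
  rw [← hr]
  refine (EReal.coe_le_coe_iff.2 hmain).trans_eq ?_
  rw [ENat.toENNReal_coe]
  rfl
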